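/- Let $\Gamma\subset \mathrm{PSL}_2(\mathbb R)$ be a discrete group acting freely on the hyperbolic plane $\mathbb H$ with compact quotient $X=\Gamma\backslash\mathbb H$, let $\rho:\Gamma\to U(V_\rho)$ be a unitary representation on a finite-dimensional complex inner product space $V_\rho$, let $n\ge 0$ and let $\phi_n:\Gamma\to\mathcal S_n$ be a homomorphism to the group of permutations of $[n]=\{1,\dots,n\}$. Let $\Gamma$ act on $\mathbb H\times[n]$ by $\gamma(z,j)=(\gamma z,\phi_n(\gamma)(j))$ and let $X_n=\Gamma\backslash(\mathbb H\times[n])$ be the corresponding (possibly disconnected) cover of $X$ of degree $n$. For a finite-dimensional unitary representation $\varrho:\Gamma\to U(W)$, the twisted Laplacian $\Delta_\varrho$ on $X$ is the closure, in the Hilbert space $L^2(F;W)$ with respect to hyperbolic area on a compact fundamental domain $F$ of $\Gamma$ in $\mathbb H$, of the hyperbolic Laplacian $-y^2(\partial_x^2+\partial_y^2)$ on the smooth functions $\psi:\mathbb H\to W$ with $\psi(\gamma z)=\varrho(\gamma)\psi(z)$ for all $\gamma\in\Gamma$. Likewise $\Delta_{n,\rho}$ on $X_n$ is the closure, in $L^2(D;V_\rho)$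 for a compact fundamental domain $D$ of $\Gamma$ in $\mathbb H\times[n]$, of the hyperbolic Laplacian (acting on each copy of $\mathbb H$) on the smooth functions $\psi:\mathbb H\times[n]\to V_\rho$ with $\psi(\gamma z,\phi_n(\gamma)(j))=\rho(\gamma)\psi(z,j)$ for all $\gamma\in\Gamma$. Then there is a unitary representation $\varrho_n:\Gamma\to U(V_n)$ on $V_n=V_\rho^{\,n}$ (orthogonal direct sum), of dimension $\dim V_n=n\dim V_\rho$, such that: 1. $\varrho_n$ is the induced representation: if $R\subset[n]$ contains exactly one point of each orbit of $\Gamma$ on $[n]$ and $\Gamma_i=\{\gamma\in\Gamma:\phi_n(\gamma)(i)=i\}$, then $\varrho_n\cong\bigoplus_{i\in R}\mathrm{Ind}_{\Gamma_i}^{\Gamma}(\rho|_{\Gamma_i})$ as representations of $\Gamma$ (in particular $\varrho_n\cong\mathrm{Ind}_{\Gamma_1}^{\Gamma}(\rho|_{\Gamma_1})$ if $X_n$ is connected and non-empty). 2. For all compact fundamental domains $F$ and $D$ as above, $\Delta_{n,\rho}$ and $\Delta_{\varrho_n}$ have the same spectrum, with the same multiplicities: $\dim\ker(\Delta_{n,\rho}-\lambda)=\dim\ker(\Delta_{\varrho_n}-\lambda)$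 for every $\lambda\in\mathbb C$. 3. For all $\gamma\in\Gamma$, $\mathrm{Tr}\,\varrho_n(\gamma)=\mathrm{Tr}\,\rho(\gamma)\cdot|\mathrm{Fix}(\phi_n(\gamma))|$, where $\mathrm{Fix}(\phi_n(\gamma))\subset[n]$ is the set of fixed points of $\phi_n(\gamma)$. -/

import Mathlib

open MeasureTheory UpperHalfPlane
open scoped MatrixGroups ContDiff

noncomputable section

namespace TwistedLaplacian

/-! ### The group `PSL(2, ℝ)` acting on the hyperbolic plane -/

lemma center_smul (g : SL(2, ℝ)) (hg : g ∈ Subgroup.center SL(2, ℝ)) (z : ℍ) : g • z = z := by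
  obtain ⟨r, hr, hrg⟩ := Matrix.SpecialLinearGroup.mem_center_iff.mp hg
  have hr0 : r ≠ 0 := by
    rintro rfl
    simp at hr
  have h00 : g 0 0 = r := by
    rw [← hrg]; simp
  have h01 : g 0 1 = 0 := by
    rw [← hrg]; simp
  have h10 : g 1 0 = 0 := by
    rw [← hrg]; simp
  have h11 : g 1 1 = r := by
    rw [← hrg]; simp
  apply UpperHalfPlane.ext
  rw [UpperHalfPlane.coe_specialLinearGroup_apply]
  have hrc : (r : ℂ) ≠ 0 := by exact_mod_cast hr0
  simp [h00, h01, h10, h11, hrc]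

/-- The action of `PSL(2, ℝ)` on the upper half-plane by Möbius transformations: the class of
`g ∈ SL(2, ℝ)` acts as `g`. -/
instance instMulActionPSL : MulAction PSL(2, ℝ) ℍ :=
  MulAction.compHom ℍ
    (QuotientGroup.lift (Subgroup.center SL(2, ℝ)) (MulAction.toPermHom SL(2, ℝ) ℍ)
      (fun g hg => Equiv.ext fun z => center_smul g hg z))

lemma mk_smul (g : SL(2, ℝ)) (z : ℍ) : (QuotientGroup.mk g : PSL(2, ℝ)) • z = g • z := rfl

/-- `Γ` is a discrete subgroup of `PSL(2, ℝ)` acting freely on `ℍ` with compact quotient, so that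
`Γ \ ℍ` is a compact hyperbolic surface. -/
structure IsCompactSurfaceGroup (Γ : Subgroup PSL(2, ℝ)) : Prop where
  discrete : DiscreteTopology Γ
  free : ∀ γ : Γ, γ ≠ 1 → ∀ z : ℍ, γ • z ≠ z
  cocompact : CompactSpace (MulAction.orbitRel.Quotient Γ ℍ)

/-! ### Closed operators and their spectra -/

section Operators

variable {E : Type*} [NormedAddCommGroup E] [NormedSpace ℂ E]

/-- The spectrum of an unbounded operator `A`: the set of `c` such that `A - c` does not have a
bounded, everywhere defined, two-sided inverse. -/
def spectrum (A : E →ₗ.[ℂ] E) : Set ℂ :=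
  {c | ¬ ∃ R : E →L[ℂ] E, (∀ u : A.domain, R (A u - c • (u : E)) = u) ∧
    ∀ v : E, ∃ u : A.domain, (u : E) = R v ∧ A u - c • (u : E) = v}

/-- The eigenspace `ker (A - c)` of an unbounded operator. -/
def eigenspace (A : E →ₗ.[ℂ] E) (c : ℂ) : Submodule ℂ A.domain :=
  LinearMap.ker (A.toFun - c • A.domain.subtype)

end Operators

section L2

variable {V : Type*} [NormedAddCommGroup V] [InnerProductSpace ℂ V]
  {M : Type*} [MeasurableSpace M]

/-- The graph in `L²(M, μ; V)` of an operator `L` given on a space `S` of functions `M → V`. -/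
def l2Graph (μ : Measure M) (S : Submodule ℂ (M → V)) (L : S →ₗ[ℂ] (M → V)) :
    Submodule ℂ (Lp V 2 μ × Lp V 2 μ) where
  carrier := {p | ∃ ψ : S, p.1 =ᵐ[μ] (ψ : M → V) ∧ p.2 =ᵐ[μ] L ψ}
  zero_mem' := ⟨0, by simpa using Lp.coeFn_zero V 2 μ, by simpa using Lp.coeFn_zero V 2 μ⟩
  add_mem' := by
    rintro p q ⟨ψ, h₁, h₂⟩ ⟨ξ, k₁, k₂⟩
    refine ⟨ψ + ξ, (Lp.coeFn_add p.1 q.1).trans ?_, (Lp.coeFn_add p.2 q.2).trans ?_⟩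
    · exact h₁.add k₁
    · rw [map_add]
      exact h₂.add k₂
  smul_mem' := by
    rintro c p ⟨ψ, h₁, h₂⟩
    refine ⟨c • ψ, (Lp.coeFn_smul c p.1).trans ?_, (Lp.coeFn_smul c p.2).trans ?_⟩
    · exact h₁.const_smul c
    · rw [map_smul]
      exact h₂.const_smul c

/-- The closure in `L²(M, μ; V)` of an operator `L` given on a space `S` of functions: the
operator whose graph is the closure of the graph of `L`. When `L` is essentially self-adjoint, this
is its unique self-adjoint extension. -/
def l2Closure (μ : Measure M) (S : Submodule ℂ (M → V)) (L : S →ₗ[ℂ] (M → V)) :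
    Lp V 2 μ →ₗ.[ℂ] Lp V 2 μ :=
  (l2Graph μ S L).topologicalClosure.toLinearPMap

end L2

/-! ### The hyperbolic Laplacian -/

section Laplacian

variable {V : Type*} [NormedAddCommGroup V] [InnerProductSpace ℂ V]

/-- Smooth vector-valued functions on the hyperbolic plane. -/
def IsSmooth (ψ : ℍ → V) : Prop :=
  ContDiffOn ℝ ∞ (fun z : ℂ => ψ (ofComplex z)) {z | 0 < z.im}

/-- The (positive) hyperbolic Laplacian `-y² (∂²/∂x² + ∂²/∂y²)`. -/
def hypLaplacian (ψ : ℍ → V) (z : ℍ) : V :=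
  -(z.im ^ 2 • Laplacian.laplacian (fun w : ℂ => ψ (ofComplex w)) (z : ℂ))

lemma IsSmooth.contDiffAt {ψ : ℍ → V} (h : IsSmooth ψ) (z : ℍ) :
    ContDiffAt ℝ 2 (fun w : ℂ => ψ (ofComplex w)) (z : ℂ) :=
  (ContDiffOn.contDiffAt h (isOpen_upperHalfPlaneSet.mem_nhds z.im_pos)).of_le
    (WithTop.coe_le_coe.2 (le_top : (2 : ℕ∞) ≤ ⊤))

lemma IsSmooth.zero : IsSmooth (0 : ℍ → V) := contDiffOn_const

lemma IsSmooth.add {ψ ξ : ℍ → V} (hψ : IsSmooth ψ) (hξ : IsSmooth ξ) : IsSmooth (ψ + ξ) :=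
  ContDiffOn.add hψ hξ

lemma IsSmooth.smul {ψ : ℍ → V} (c : ℂ) (hψ : IsSmooth ψ) : IsSmooth (c • ψ) :=
  ContDiffOn.const_smul c hψ

lemma hypLaplacian_add {ψ ξ : ℍ → V} (hψ : IsSmooth ψ) (hξ : IsSmooth ξ) :
    hypLaplacian (ψ + ξ) = hypLaplacian ψ + hypLaplacian ξ := by
  funext z
  have := (hψ.contDiffAt z).laplacian_add (hξ.contDiffAt z)
  simp only [hypLaplacian, Pi.add_apply]
  rw [← neg_add, ← smul_add]
  exact congrArg (fun v => -(z.im ^ 2 • v)) this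

lemma hypLaplacian_smul {ψ : ℍ → V} (c : ℂ) (hψ : IsSmooth ψ) :
    hypLaplacian (c • ψ) = c • hypLaplacian ψ := by
  funext z
  have := InnerProductSpace.laplacian_smul c (hψ.contDiffAt z)
  simp only [hypLaplacian, Pi.smul_apply]
  rw [smul_neg, smul_comm c]
  exact congrArg (fun v => -(z.im ^ 2 • v)) this

variable {Γ : Subgroup PSL(2, ℝ)}

/-! ### The twisted Laplacian on `X = Γ \ ℍ` -/

/-- The smooth functions `ψ : ℍ → V` with `ψ (γ z) = ρ(γ) ψ(z)` for all `γ ∈ Γ`. -/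
def sections (ρ : Γ →* (V ≃ₗᵢ[ℂ] V)) : Submodule ℂ (ℍ → V) where
  carrier := {ψ | IsSmooth ψ ∧ ∀ (γ : Γ) (z : ℍ), ψ (γ • z) = ρ γ (ψ z)}
  zero_mem' := ⟨IsSmooth.zero, by simp⟩
  add_mem' := fun hψ hξ => ⟨hψ.1.add hξ.1, fun γ z => by simp [hψ.2 γ z, hξ.2 γ z]⟩
  smul_mem' := fun c _ hψ => ⟨hψ.1.smul c, fun γ z => by simp [hψ.2 γ z]⟩

/-- The hyperbolic Laplacian on smooth `ρ`-equivariant functions. -/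
def sectionsLaplacian (ρ : Γ →* (V ≃ₗᵢ[ℂ] V)) : sections ρ →ₗ[ℂ] (ℍ → V) where
  toFun ψ := hypLaplacian (ψ : ℍ → V)
  map_add' ψ ξ := hypLaplacian_add ψ.2.1 ξ.2.1
  map_smul' c ψ := hypLaplacian_smul c ψ.2.1

/-- The twisted Laplacian `Δ_ρ` of `X = Γ \ ℍ`, as a closed operator on `L²(F; V)`, where `F` is a
fundamental domain of `Γ` and `ρ`-equivariant functions are identified with their restrictions
to `F`. -/
def twistedLaplacian (ρ : Γ →* (V ≃ₗᵢ[ℂ] V)) (F : Set ℍ) :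
    Lp V 2 (volume.restrict F) →ₗ.[ℂ] Lp V 2 (volume.restrict F) :=
  l2Closure (volume.restrict F) (sections ρ) (sectionsLaplacian ρ)

/-! ### The twisted Laplacian on the cover `X_n = Γ \ (ℍ × [n])` -/

variable {n : ℕ}

/-- The action `γ (z, j) = (γ z, φ(γ) j)` of `Γ` on `ℍ × [n]`; its quotient is the cover `X_n`. -/
@[reducible]
def coverAction (φ : Γ →* Equiv.Perm (Fin n)) : MulAction Γ (ℍ × Fin n) where
  smul γ p := (γ • p.1, φ γ p.2)
  one_smul p := Prod.ext (one_smul Γ p.1) (by change φ 1 p.2 = p.2; simp)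
  mul_smul a b p := Prod.ext (mul_smul a b p.1) (by
    change φ (a * b) p.2 = φ a (φ b p.2)
    simp)

/-- The hyperbolic area measure of `ℍ × [n]`, a disjoint union of `n` copies of `ℍ`. -/
def coverVolume (n : ℕ) : Measure (ℍ × Fin n) := (volume : Measure ℍ).prod Measure.count

/-- `D` is a fundamental domain of the action of `Γ` on `ℍ × [n]`. -/
def IsCoverFundamentalDomain (φ : Γ →* Equiv.Perm (Fin n)) (D : Set (ℍ × Fin n)) : Prop :=
  letI := coverAction φ
  IsFundamentalDomain Γ D (coverVolume n)

/-- The smooth functions `ψ : ℍ × [n] → V` with `ψ (γ z, φ(γ) j) = ρ(γ) ψ(z, j)` for all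
`γ ∈ Γ`, i.e. the smooth sections over `X_n` of the flat bundle defined by `ρ`. -/
def coverSections (φ : Γ →* Equiv.Perm (Fin n)) (ρ : Γ →* (V ≃ₗᵢ[ℂ] V)) :
    Submodule ℂ (ℍ × Fin n → V) where
  carrier := {ψ | (∀ j, IsSmooth fun z => ψ (z, j)) ∧
    ∀ (γ : Γ) (z : ℍ) (j : Fin n), ψ (γ • z, φ γ j) = ρ γ (ψ (z, j))}
  zero_mem' := ⟨fun _ => IsSmooth.zero, by simp⟩
  add_mem' := fun hψ hξ =>
    ⟨fun j => (hψ.1 j).add (hξ.1 j), fun γ z j => by simp [hψ.2 γ z j, hξ.2 γ z j]⟩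
  smul_mem' := fun c _ hψ => ⟨fun j => (hψ.1 j).smul c, fun γ z j => by simp [hψ.2 γ z j]⟩

/-- The hyperbolic Laplacian on smooth equivariant functions on `ℍ × [n]`, acting on each sheet. -/
def coverSectionsLaplacian (φ : Γ →* Equiv.Perm (Fin n)) (ρ : Γ →* (V ≃ₗᵢ[ℂ] V)) :
    coverSections φ ρ →ₗ[ℂ] (ℍ × Fin n → V) where
  toFun ψ p := hypLaplacian (fun z => (ψ : ℍ × Fin n → V) (z, p.2)) p.1
  map_add' ψ ξ := funext fun p =>
    congrFun (hypLaplacian_add (ψ.2.1 p.2) (ξ.2.1 p.2)) p.1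
  map_smul' c ψ := funext fun p =>
    congrFun (hypLaplacian_smul c (ψ.2.1 p.2)) p.1

/-- The Laplacian `Δ_{n,ρ}` of the cover `X_n = Γ \ (ℍ × [n])` twisted by `ρ`, as a closed operator
on `L²(D; V)`, where `D` is a fundamental domain of `Γ` acting on `ℍ × [n]`. -/
def coverLaplacian (φ : Γ →* Equiv.Perm (Fin n)) (ρ : Γ →* (V ≃ₗᵢ[ℂ] V))
    (D : Set (ℍ × Fin n)) :
    Lp V 2 ((coverVolume n).restrict D) →ₗ.[ℂ] Lp V 2 ((coverVolume n).restrict D) :=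
  l2Closure ((coverVolume n).restrict D) (coverSections φ ρ) (coverSectionsLaplacian φ ρ)

/-! ### Induced representations -/

/-- The linear representation underlying a unitary representation. -/
def toRep {G : Type*} [Group G] (ρ : G →* (V ≃ₗᵢ[ℂ] V)) : Representation ℂ G V where
  toFun g := (ρ g).toLinearEquiv.toLinearMap
  map_one' := by rw [map_one]; rfl
  map_mul' a b := by rw [map_mul]; rfl

/-- The stabilizer in `Γ` of the point `i ∈ [n]`. -/
def stab (φ : Γ →* Equiv.Perm (Fin n)) (i : Fin n) : Subgroup Γ where
  carrier := {γ | φ γ i = i}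
  one_mem' := by simp
  mul_mem' := by
    intro a b (ha : φ a i = i) (hb : φ b i = i)
    change φ (a * b) i = i
    rw [map_mul, Equiv.Perm.mul_apply, hb, ha]
  inv_mem' := by
    intro a (ha : φ a i = i)
    change φ a⁻¹ i = i
    rw [map_inv, Equiv.Perm.inv_eq_iff_eq, ha]

/-- `R` contains exactly one point of each orbit of `Γ` on `[n]`. -/
def IsOrbitTransversal (φ : Γ →* Equiv.Perm (Fin n)) (R : Set (Fin n)) : Prop :=
  ∀ j, ∃! i, i ∈ R ∧ ∃ γ : Γ, φ γ i = j

/-- The direct sum over `i ∈ R` of the representations of `Γ` induced from the restrictions of `ρ`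
to the stabilizers of `i`. For transitive `φ` and `R = {i}` it is the representation induced from
the restriction of `ρ` to the stabilizer of `i`. -/
def inducedRep (φ : Γ →* Equiv.Perm (Fin n)) (ρ : Γ →* (V ≃ₗᵢ[ℂ] V)) (R : Set (Fin n)) :=
  Representation.directSum fun i : R =>
    Representation.ind (stab φ (i : Fin n)).subtype ((toRep ρ).comp (stab φ (i : Fin n)).subtype)

end Laplacian

end TwistedLaplacian

end

/-!
A function on `ℍ × [n]` is the same as a `Vⁿ`-valued function on `ℍ`, and currying turns
`(ρ, φ)`-equivariance into equivariance for the tensor product `ϱ` of `ρ` with the permutation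
representation of `φ`. On `L²` this is a unitary map that carries the Laplacian on smooth sections
over the cover to the one on smooth sections of the flat bundle of `ϱ`, provided that the
fundamental domain of `Γ` in `ℍ × [n]` is `F × [n]`. An arbitrary fundamental domain may be replaced
by this one: an equivariant function is determined by its values on any fundamental domain, with
the same `L²` norm, and the Laplacian of an equivariant function is equivariant because the
hyperbolic Laplacian commutes with isometries. Unitary equivalence passes to closures, hence to
spectra and eigenspaces. The trace of a tensor product is the product of the traces, and the
permutation module is the direct sum of the modules induced from the trivial representations of
stabilizers, so the projection formula identifies `ϱ` with the direct sum of the representations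
induced from the restrictions of `ρ`.
-/

universe u

noncomputable section

namespace TwistedLaplacian

/-! ### Unitary equivalence of unbounded operators -/

section Transport

variable {E E' : Type*} [NormedAddCommGroup E] [NormedSpace ℂ E]
  [NormedAddCommGroup E'] [NormedSpace ℂ E']

lemma mem_eigenspace_iff (A : E →ₗ.[ℂ] E) (c : ℂ) (x : A.domain) :
    x ∈ eigenspace A c ↔ A x = c • (x : E) := by
  rw [eigenspace, LinearMap.mem_ker, LinearMap.sub_apply, sub_eq_zero]
  rfl

/-- `T` carries the unbounded operator `A` to the unbounded operator `A'`. -/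
structure Intertwines (T : E ≃L[ℂ] E') (A : E →ₗ.[ℂ] E) (A' : E' →ₗ.[ℂ] E') : Prop where
  mem_domain_iff : ∀ x, T x ∈ A'.domain ↔ x ∈ A.domain
  map_apply : ∀ (x : A.domain) (y : A'.domain), (y : E') = T x → A' y = T (A x)

namespace Intertwines

variable {T : E ≃L[ℂ] E'} {A : E →ₗ.[ℂ] E} {A' : E' →ₗ.[ℂ] E'}

lemma symm (h : Intertwines T A A') : Intertwines T.symm A' A where
  mem_domain_iff x := by rw [← h.mem_domain_iff, T.apply_symm_apply]
  map_apply x y hxy := by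
    rw [h.map_apply y x (by rw [hxy, T.apply_symm_apply]), T.symm_apply_apply]

lemma trans {E'' : Type*} [NormedAddCommGroup E''] [NormedSpace ℂ E''] {A'' : E'' →ₗ.[ℂ] E''}
    {T' : E' ≃L[ℂ] E''} (h : Intertwines T A A') (h' : Intertwines T' A' A'') :
    Intertwines (T.trans T') A A'' where
  mem_domain_iff x := (h'.mem_domain_iff (T x)).trans (h.mem_domain_iff x)
  map_apply x y hxy := by
    have hx : T x ∈ A'.domain := (h.mem_domain_iff x).2 x.2
    rw [h'.map_apply ⟨T x, hx⟩ y hxy, h.map_apply x ⟨T x, hx⟩ rfl]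
    rfl

lemma spectrum_subset (h : Intertwines T A A') : spectrum A' ⊆ spectrum A := by
  rintro c hc ⟨R, h₁, h₂⟩
  refine hc ⟨(T : E →L[ℂ] E') ∘L R ∘L (T.symm : E' →L[ℂ] E), fun u => ?_, fun v => ?_⟩
  · have hu : T.symm u ∈ A.domain := (h.symm.mem_domain_iff u).2 u.2
    have := h₁ ⟨T.symm u, hu⟩
    rw [h.symm.map_apply u ⟨T.symm u, hu⟩ rfl] at this
    simp only [ContinuousLinearMap.comp_apply, ContinuousLinearEquiv.coe_coe, map_sub, map_smul]
    simp only [map_sub, map_smul] at this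
    rw [← map_smul, ← map_sub, this, T.apply_symm_apply]
  · obtain ⟨u, hu, huv⟩ := h₂ (T.symm v)
    refine ⟨⟨T u, (h.mem_domain_iff u).2 u.2⟩, by simp [hu], ?_⟩
    rw [h.map_apply u ⟨T u, _⟩ rfl]
    simp only
    rw [← map_smul, ← map_sub, huv, T.apply_symm_apply]

lemma spectrum_eq (h : Intertwines T A A') : spectrum A = spectrum A' :=
  h.symm.spectrum_subset.antisymm h.spectrum_subset

/-- The linear equivalence of domains given by an intertwiner. -/
def domainEquiv (h : Intertwines T A A') : A.domain ≃ₗ[ℂ] A'.domain where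
  toFun x := ⟨T x, (h.mem_domain_iff x).2 x.2⟩
  invFun y := ⟨T.symm y, (h.symm.mem_domain_iff y).2 y.2⟩
  map_add' x y := by ext; simp
  map_smul' c x := by ext; simp
  left_inv x := by simp
  right_inv x := by simp

lemma map_eigenspace (h : Intertwines T A A') (c : ℂ) :
    (eigenspace A c).map (h.domainEquiv : A.domain →ₗ[ℂ] A'.domain) = eigenspace A' c := by
  ext y
  obtain ⟨x, rfl⟩ := h.domainEquiv.surjective y
  have hx : A' (h.domainEquiv x) = T (A x) := h.map_apply x _ rfl
  have hx' : ((h.domainEquiv x : A'.domain) : E') = T x := rfl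
  rw [Submodule.mem_map_equiv, LinearEquiv.symm_apply_apply, mem_eigenspace_iff,
    mem_eigenspace_iff, hx, hx', ← map_smul, T.injective.eq_iff]

end Intertwines

lemma Intertwines.rank_eigenspace_eq {E E' : Type u} [NormedAddCommGroup E] [NormedSpace ℂ E]
    [NormedAddCommGroup E'] [NormedSpace ℂ E'] {T : E ≃L[ℂ] E'} {A : E →ₗ.[ℂ] E}
    {A' : E' →ₗ.[ℂ] E'} (h : Intertwines T A A') (c : ℂ) :
    Module.rank ℂ (eigenspace A c) = Module.rank ℂ (eigenspace A' c) := by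
  rw [← h.map_eigenspace c]
  exact (h.domainEquiv.submoduleMap (eigenspace A c)).rank_eq

/-- `toLinearPMap` of a submodule that is not a graph has the junk value `0`. Transport respects it,
so closability of the Laplacian need not be proved. -/
lemma toLinearPMap_apply_of_not {g : Submodule ℂ (E × E)}
    (hg : ¬ ∀ x ∈ g, x.1 = 0 → x.2 = 0) (x : g.toLinearPMap.domain) :
    g.toLinearPMap x = 0 := by
  classical
  change (if hg : _ then g.toLinearPMapAux hg else 0) x = _
  rw [dif_neg hg]
  rfl

lemma intertwines_toLinearPMap {T : E ≃L[ℂ] E'} {g : Submodule ℂ (E × E)}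
    {g' : Submodule ℂ (E' × E')} (h : ∀ x y, (T x, T y) ∈ g' ↔ (x, y) ∈ g) :
    Intertwines T g.toLinearPMap g'.toLinearPMap where
  mem_domain_iff x := by
    simp only [Submodule.toLinearPMap_domain, Submodule.mem_map, LinearMap.fst_apply, Prod.exists,
      exists_and_right, exists_eq_right]
    rw [T.surjective.exists]
    simp only [h]
  map_apply x y hxy := by
    by_cases hg : ∀ x ∈ g, x.1 = 0 → x.2 = 0
    · have hg' : ∀ x ∈ g', x.1 = 0 → x.2 = 0 := by
        rintro ⟨a, b⟩ hab (rfl : a = 0)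
        obtain ⟨b, rfl⟩ := T.surjective b
        rw [← map_zero T, h] at hab
        change T b = 0
        rw [show b = 0 from hg _ hab rfl, map_zero]
      have hy := g'.mem_graph_toLinearPMap hg' y
      have hx := (h _ _).2 (g.mem_graph_toLinearPMap hg x)
      have := hg' _ (g'.sub_mem hy hx) (by simp [hxy])
      exact sub_eq_zero.1 this
    · have hg' : ¬ ∀ x ∈ g', x.1 = 0 → x.2 = 0 := fun hg' => hg <| by
        rintro ⟨a, b⟩ hab (rfl : a = 0)
        have := hg' _ ((h _ _).2 hab) (map_zero T)
        exact T.map_eq_zero_iff.1 this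
      rw [toLinearPMap_apply_of_not hg, toLinearPMap_apply_of_not hg', map_zero]

lemma mem_topologicalClosure_prod_iff {T : E ≃L[ℂ] E'} {g : Submodule ℂ (E × E)}
    {g' : Submodule ℂ (E' × E')} (h : ∀ x y, (T x, T y) ∈ g' ↔ (x, y) ∈ g) (x y : E) :
    (T x, T y) ∈ g'.topologicalClosure ↔ (x, y) ∈ g.topologicalClosure := by
  have hg : (g : Set (E × E)) = (T.prodCongr T) ⁻¹' (g' : Set (E' × E')) := by
    ext ⟨a, b⟩
    exact (h a b).symm
  rw [← SetLike.mem_coe, ← SetLike.mem_coe, Submodule.topologicalClosure_coe,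
    Submodule.topologicalClosure_coe, hg]
  change _ ↔ _ ∈ closure ((T.prodCongr T).toHomeomorph ⁻¹' (g' : Set (E' × E')))
  rw [← Homeomorph.preimage_closure]
  rfl

/-- Some surjective linear isometry carries `A` to `A'`. -/
def UnitarilyEquivalent (A : E →ₗ.[ℂ] E) (A' : E' →ₗ.[ℂ] E') : Prop :=
  ∃ T : E ≃ₗᵢ[ℂ] E', Intertwines T.toContinuousLinearEquiv A A'

lemma UnitarilyEquivalent.trans {E'' : Type*} [NormedAddCommGroup E''] [NormedSpace ℂ E'']
    {A : E →ₗ.[ℂ] E} {A' : E' →ₗ.[ℂ] E'} {A'' : E'' →ₗ.[ℂ] E''} :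
    UnitarilyEquivalent A A' → UnitarilyEquivalent A' A'' → UnitarilyEquivalent A A'' :=
  fun ⟨T, hT⟩ ⟨T', hT'⟩ => ⟨T.trans T', Intertwines.trans hT hT'⟩

lemma UnitarilyEquivalent.spectrum_eq {A : E →ₗ.[ℂ] E} {A' : E' →ₗ.[ℂ] E'} :
    UnitarilyEquivalent A A' → spectrum A = spectrum A' :=
  fun ⟨_, hT⟩ => hT.spectrum_eq

lemma UnitarilyEquivalent.rank_eigenspace_eq {E E' : Type u} [NormedAddCommGroup E]
    [NormedSpace ℂ E] [NormedAddCommGroup E'] [NormedSpace ℂ E'] {A : E →ₗ.[ℂ] E}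
    {A' : E' →ₗ.[ℂ] E'} (h : UnitarilyEquivalent A A') (c : ℂ) :
    Module.rank ℂ (eigenspace A c) = Module.rank ℂ (eigenspace A' c) :=
  h.elim fun _ hT => hT.rank_eigenspace_eq c

end Transport

lemma intertwines_l2Closure {V V' M M' : Type*} [NormedAddCommGroup V] [InnerProductSpace ℂ V]
    [NormedAddCommGroup V'] [InnerProductSpace ℂ V'] [MeasurableSpace M] [MeasurableSpace M']
    {μ : Measure M} {ν : Measure M'} {S : Submodule ℂ (M → V)} {L : S →ₗ[ℂ] (M → V)}
    {S' : Submodule ℂ (M' → V')} {L' : S' →ₗ[ℂ] (M' → V')} {T : Lp V 2 μ ≃L[ℂ] Lp V' 2 ν}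
    (h : ∀ x y, (T x, T y) ∈ l2Graph ν S' L' ↔ (x, y) ∈ l2Graph μ S L) :
    Intertwines T (l2Closure μ S L) (l2Closure ν S' L') :=
  intertwines_toLinearPMap (mem_topologicalClosure_prod_iff h)

/-! ### Equivariant functions and fundamental domains -/

section Equivariant

variable {𝕜 G M W : Type*} [NormedField 𝕜] [Group G] [MulAction G M] [NormedAddCommGroup W]
  [NormedSpace 𝕜 W] {s t : Set M}

variable (M) in
/-- The functions `f : M → W` with `f (g • x) = ϱ(g) f(x)`. -/
def equivariantFunctions (ϱ : G →* (W ≃ₗᵢ[𝕜] W)) : Submodule 𝕜 (M → W) where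
  carrier := {f | ∀ (g : G) (x : M), f (g • x) = ϱ g (f x)}
  zero_mem' := by simp
  add_mem' := fun hf hf' g x => by simp [hf g x, hf' g x]
  smul_mem' := fun c _ hf g x => by simp [hf g x]

open Classical in
/-- The equivariant function that agrees with `f` on the fundamental interior of `s` and vanishes
on the orbits that do not meet it. -/
def equivariantExtension (ϱ : G →* (W ≃ₗᵢ[𝕜] W)) (s : Set M) (f : M → W) (x : M) : W :=
  if h : ∃ g : G, g • x ∈ fundamentalInterior G s then ϱ h.choose⁻¹ (f (h.choose • x)) else 0

lemma eq_of_smul_mem_fundamentalInterior {g h : G} {x : M}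
    (hg : g • x ∈ fundamentalInterior G s) (hh : h • x ∈ fundamentalInterior G s) : g = h := by
  by_contra hne
  refine (mem_fundamentalInterior.1 hg).2 (g * h⁻¹) (mul_inv_eq_one.not.2 hne) ?_
  rw [Set.mem_smul_set_iff_inv_smul_mem, smul_smul, mul_inv_rev, inv_inv, inv_mul_cancel_right]
  exact fundamentalInterior_subset hh

lemma equivariantExtension_apply (ϱ : G →* (W ≃ₗᵢ[𝕜] W)) (f : M → W) {g : G} {x : M}
    (hg : g • x ∈ fundamentalInterior G s) :
    equivariantExtension ϱ s f x = ϱ g⁻¹ (f (g • x)) := by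
  have h : ∃ g : G, g • x ∈ fundamentalInterior G s := ⟨g, hg⟩
  rw [equivariantExtension, dif_pos h, eq_of_smul_mem_fundamentalInterior h.choose_spec hg]

lemma equivariantExtension_mem (ϱ : G →* (W ≃ₗᵢ[𝕜] W)) (s : Set M) (f : M → W) :
    equivariantExtension ϱ s f ∈ equivariantFunctions M ϱ := by
  intro g x
  by_cases h : ∃ k : G, k • x ∈ fundamentalInterior G s
  · obtain ⟨k, hk⟩ := h
    have hkg : (k * g⁻¹) • g • x ∈ fundamentalInterior G s := by
      rwa [smul_smul, inv_mul_cancel_right]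
    rw [equivariantExtension_apply ϱ f hk, equivariantExtension_apply ϱ f hkg, smul_smul,
      inv_mul_cancel_right, mul_inv_rev, inv_inv, map_mul]
    rfl
  · have h' : ¬ ∃ k : G, k • g • x ∈ fundamentalInterior G s := fun ⟨k, hk⟩ =>
      h ⟨k * g, by rwa [mul_smul]⟩
    rw [equivariantExtension, equivariantExtension, dif_neg h, dif_neg h', map_zero]

variable [MeasurableSpace M] {μ : Measure M} [Countable G]

lemma equivariantExtension_ae_eq (hs : IsFundamentalDomain G s μ) (ϱ : G →* (W ≃ₗᵢ[𝕜] W))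
    (f : M → W) : equivariantExtension ϱ s f =ᵐ[μ.restrict s] f := by
  have hfrontier := measure_eq_zero_iff_ae_notMem.1 hs.measure_fundamentalFrontier
  refine (ae_restrict_iff'₀ hs.nullMeasurableSet).2 (hfrontier.mono fun x hx hxs => ?_)
  have hx' : (1 : G) • x ∈ fundamentalInterior G s := by
    rw [one_smul]
    exact ((fundamentalInterior_union_fundamentalFrontier G s).ge hxs).resolve_right hx
  rw [equivariantExtension_apply ϱ f hx', inv_one, map_one, one_smul]
  rfl

variable [MeasurableConstSMul G M] [SMulInvariantMeasure G M μ]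

lemma ae_eq_of_ae_eq_restrict_of_equivariant (hs : IsFundamentalDomain G s μ)
    {ϱ : G →* (W ≃ₗᵢ[𝕜] W)} {f f' : M → W} (hf : f ∈ equivariantFunctions M ϱ)
    (hf' : f' ∈ equivariantFunctions M ϱ) (h : f =ᵐ[μ.restrict s] f') : f =ᵐ[μ] f' := by
  refine hs.measure_zero_of_invariant _ (fun g => Set.ext fun x => ?_) ?_
  · simp [Set.mem_smul_set_iff_inv_smul_mem, hf g⁻¹ x, hf' g⁻¹ x]
  · exact le_antisymm ((Measure.le_restrict_apply _ _).trans_eq h) zero_le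

lemma aestronglyMeasurable_of_equivariant (hs : IsFundamentalDomain G s μ)
    {ϱ : G →* (W ≃ₗᵢ[𝕜] W)} {f : M → W} (hf : f ∈ equivariantFunctions M ϱ)
    (h : AEStronglyMeasurable f (μ.restrict s)) : AEStronglyMeasurable f μ := by
  rw [← hs.sum_restrict, aestronglyMeasurable_sum_measure_iff]
  intro g
  have he : MeasurableEmbedding (g • · : M → M) := measurableEmbedding_const_smul _
  rw [← Set.image_smul, ← ((measurePreserving_smul g μ).restrict_image_emb he
    _).aestronglyMeasurable_comp_iff he]
  have hfg : f ∘ (g • ·) = fun x => ϱ g (f x) := funext (hf g)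
  rw [hfg]
  exact (ϱ g).continuous.comp_aestronglyMeasurable h

lemma eLpNorm_restrict_eq_of_equivariant (hs : IsFundamentalDomain G s μ)
    (ht : IsFundamentalDomain G t μ) {ϱ : G →* (W ≃ₗᵢ[𝕜] W)} {f : M → W}
    (hf : f ∈ equivariantFunctions M ϱ) (p : ENNReal) :
    eLpNorm f p (μ.restrict s) = eLpNorm f p (μ.restrict t) := by
  have henorm (g : G) (x : M) : ‖f (g • x)‖ₑ = ‖f x‖ₑ := by
    rw [hf g x, LinearIsometryEquiv.enorm_map]
  rcases eq_or_ne p 0 with rfl | hp₀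
  · simp only [eLpNorm_exponent_zero]
  rcases eq_or_ne p ⊤ with rfl | hp
  · simp only [eLpNorm_exponent_top, eLpNormEssSup]
    rw [hs.essSup_measure_restrict henorm, ht.essSup_measure_restrict henorm]
  · simp only [eLpNorm_eq_lintegral_rpow_enorm_toReal hp₀ hp]
    rw [hs.setLIntegral_eq ht _ fun g x => by rw [henorm]]

lemma memLp_restrict_of_equivariant (hs : IsFundamentalDomain G s μ)
    (ht : IsFundamentalDomain G t μ) {ϱ : G →* (W ≃ₗᵢ[𝕜] W)} {f : M → W}
    (hf : f ∈ equivariantFunctions M ϱ) {p : ENNReal} (h : MemLp f p (μ.restrict s)) :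
    MemLp f p (μ.restrict t) :=
  ⟨(aestronglyMeasurable_of_equivariant hs hf h.1).restrict,
    (eLpNorm_restrict_eq_of_equivariant hs ht hf p).symm.trans_lt h.2⟩

variable {p : ENNReal}

lemma memLp_equivariantExtension (hs : IsFundamentalDomain G s μ)
    (ht : IsFundamentalDomain G t μ) (ϱ : G →* (W ≃ₗᵢ[𝕜] W)) (u : Lp W p (μ.restrict s)) :
    MemLp (equivariantExtension ϱ s u) p (μ.restrict t) :=
  memLp_restrict_of_equivariant hs ht (equivariantExtension_mem ϱ s u)
    ((memLp_congr_ae (equivariantExtension_ae_eq hs ϱ u)).2 (Lp.memLp u))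

/-- The function on `t` given by the equivariant extension of a function on `s`. -/
def changeDomain (hs : IsFundamentalDomain G s μ) (ht : IsFundamentalDomain G t μ)
    (ϱ : G →* (W ≃ₗᵢ[𝕜] W)) (u : Lp W p (μ.restrict s)) : Lp W p (μ.restrict t) :=
  (memLp_equivariantExtension hs ht ϱ u).toLp

lemma changeDomain_ae_eq_iff (hs : IsFundamentalDomain G s μ) (ht : IsFundamentalDomain G t μ)
    {ϱ : G →* (W ≃ₗᵢ[𝕜] W)} (u : Lp W p (μ.restrict s)) {f : M → W}
    (hf : f ∈ equivariantFunctions M ϱ) :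
    changeDomain hs ht ϱ u =ᵐ[μ.restrict t] f ↔ u =ᵐ[μ.restrict s] f := by
  have hE := equivariantExtension_mem ϱ s u
  have hs_ae : equivariantExtension ϱ s u =ᵐ[μ.restrict s] u := equivariantExtension_ae_eq hs ϱ u
  have ht_ae : changeDomain hs ht ϱ u =ᵐ[μ.restrict t] equivariantExtension ϱ s u :=
    MemLp.coeFn_toLp _
  exact
    ⟨fun h => hs_ae.symm.trans (ae_restrict_of_ae
        (ae_eq_of_ae_eq_restrict_of_equivariant ht hE hf (ht_ae.symm.trans h))),
      fun h => ht_ae.trans (ae_restrict_of_ae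
        (ae_eq_of_ae_eq_restrict_of_equivariant hs hE hf (hs_ae.trans h)))⟩

lemma changeDomain_changeDomain (hs : IsFundamentalDomain G s μ)
    (ht : IsFundamentalDomain G t μ) (ϱ : G →* (W ≃ₗᵢ[𝕜] W)) (u : Lp W p (μ.restrict s)) :
    changeDomain ht hs ϱ (changeDomain hs ht ϱ u) = u := by
  have hE := equivariantExtension_mem ϱ s u
  have hu := (equivariantExtension_ae_eq hs ϱ u).symm
  refine Lp.ext (Filter.EventuallyEq.trans ?_ hu.symm)
  rwa [changeDomain_ae_eq_iff ht hs _ hE, changeDomain_ae_eq_iff hs ht _ hE]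

/-- Equivariant functions identify the `Lᵖ` spaces of two fundamental domains. -/
def changeDomainEquiv [Fact (1 ≤ p)] (hs : IsFundamentalDomain G s μ)
    (ht : IsFundamentalDomain G t μ) (ϱ : G →* (W ≃ₗᵢ[𝕜] W)) :
    Lp W p (μ.restrict s) ≃ₗᵢ[𝕜] Lp W p (μ.restrict t) where
  toFun := changeDomain hs ht ϱ
  invFun := changeDomain ht hs ϱ
  left_inv := changeDomain_changeDomain hs ht ϱ
  right_inv := changeDomain_changeDomain ht hs ϱ
  map_add' u v := by
    have hE (w : Lp W p (μ.restrict s)) := equivariantExtension_mem ϱ s w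
    have hs_ae (w : Lp W p (μ.restrict s)) := (equivariantExtension_ae_eq hs ϱ w).symm
    have h (w : Lp W p (μ.restrict s)) := (changeDomain_ae_eq_iff hs ht w (hE w)).2 (hs_ae w)
    refine Lp.ext (Filter.EventuallyEq.trans ?_ (Lp.coeFn_add _ _).symm)
    refine Filter.EventuallyEq.trans ?_ ((h u).add (h v)).symm
    rw [changeDomain_ae_eq_iff hs ht _ (add_mem (hE u) (hE v))]
    exact (Lp.coeFn_add u v).trans ((hs_ae u).add (hs_ae v))
  map_smul' c u := by
    have hE := equivariantExtension_mem ϱ s u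
    have hs_ae := (equivariantExtension_ae_eq hs ϱ u).symm
    have h := (changeDomain_ae_eq_iff hs ht u hE).2 hs_ae
    refine Lp.ext (Filter.EventuallyEq.trans ?_ (Lp.coeFn_smul _ _).symm)
    refine Filter.EventuallyEq.trans ?_ (h.const_smul c).symm
    rw [changeDomain_ae_eq_iff hs ht _ (Submodule.smul_mem _ c hE)]
    exact (Lp.coeFn_smul c u).trans (hs_ae.const_smul c)
  norm_map' u := by
    change ‖changeDomain hs ht ϱ u‖ = ‖u‖
    rw [changeDomain, Lp.norm_toLp, Lp.norm_def, ← eLpNorm_restrict_eq_of_equivariant hs ht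
      (equivariantExtension_mem ϱ s u), eLpNorm_congr_ae (equivariantExtension_ae_eq hs ϱ u)]

end Equivariant

section DomainIndependence

variable {G M W : Type*} [Group G] [Countable G] [MulAction G M] [NormedAddCommGroup W]
  [InnerProductSpace ℂ W] {s t : Set M} [MeasurableSpace M] {μ : Measure M}
  [MeasurableConstSMul G M] [SMulInvariantMeasure G M μ]

lemma unitarilyEquivalent_l2Closure_restrict (hs : IsFundamentalDomain G s μ)
    (ht : IsFundamentalDomain G t μ) {ϱ : G →* (W ≃ₗᵢ[ℂ] W)} {S : Submodule ℂ (M → W)}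
    {L : S →ₗ[ℂ] (M → W)} (hS : S ≤ equivariantFunctions M ϱ)
    (hL : ∀ ψ, L ψ ∈ equivariantFunctions M ϱ) :
    UnitarilyEquivalent (l2Closure (μ.restrict s) S L) (l2Closure (μ.restrict t) S L) :=
  ⟨changeDomainEquiv hs ht ϱ, intertwines_l2Closure fun u v => exists_congr fun ψ =>
    and_congr (changeDomain_ae_eq_iff hs ht u (hS ψ.2)) (changeDomain_ae_eq_iff hs ht v (hL ψ))⟩

end DomainIndependence

/-! ### Currying `Lᵖ(M × ι; V) ≃ Lᵖ(M; V^ι)` -/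

section Curry

variable {M ι V : Type*} [NormedAddCommGroup V]

section Linear

variable (𝕜 : Type*) [NormedField 𝕜] [NormedSpace 𝕜 V] (p : ENNReal)

/-- A function `M × ι → V` as a function `M → V^ι`. -/
def curryPiLp : (M × ι → V) ≃ₗ[𝕜] (M → PiLp p fun _ : ι => V) where
  toFun f x := WithLp.toLp p fun j => f (x, j)
  invFun f x := f x.1 x.2
  map_add' _ _ := rfl
  map_smul' _ _ := rfl

variable {𝕜 p} in
@[simp]
lemma curryPiLp_apply (f : M × ι → V) (x : M) (j : ι) : curryPiLp 𝕜 p f x j = f (x, j) := rfl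

end Linear

lemma enorm_rpow_eq_sum_piLp [Fintype ι] {p : ENNReal} [Fact (1 ≤ p)] (hp : p ≠ ⊤)
    (v : PiLp p fun _ : ι => V) :
    ‖v‖ₑ ^ p.toReal = ∑ j, ‖v j‖ₑ ^ p.toReal := by
  have hp₀ : 0 < p.toReal :=
    ENNReal.toReal_pos (zero_lt_one.trans_le Fact.out).ne' hp
  have h : ‖v‖₊ ^ p.toReal = ∑ j, ‖v j‖₊ ^ p.toReal := by
    rw [PiLp.nnnorm_eq_sum hp, ← NNReal.rpow_mul, one_div_mul_cancel hp₀.ne', NNReal.rpow_one]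
  simp only [enorm_eq_nnnorm, ← ENNReal.coe_rpow_of_nonneg _ hp₀.le, h, ENNReal.ofNNReal_finsetSum]

variable [MeasurableSpace M] [MeasurableSpace ι]

lemma prod_count_eq_sum [Countable ι] (μ : Measure M) [SFinite μ] :
    μ.prod (Measure.count : Measure ι) = Measure.sum fun j => μ.map fun x => (x, j) := by
  rw [Measure.count, Measure.prod_sum_right]
  simp only [Measure.prod_dirac]

variable [MeasurableSingletonClass ι] {μ : Measure M} [SFinite μ]

lemma ae_prod_count_iff [Countable ι] {P : M × ι → Prop} :
    (∀ᵐ x ∂μ.prod Measure.count, P x) ↔ ∀ᵐ x ∂μ, ∀ j, P (x, j) := by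
  rw [prod_count_eq_sum, Measure.ae_sum_iff, ae_all_iff]
  exact forall_congr' fun j => (measurableEmbedding_prod_mk_right j).ae_map_iff

lemma aestronglyMeasurable_prod_count_iff [Countable ι] {f : M × ι → V} :
    AEStronglyMeasurable f (μ.prod Measure.count) ↔
      ∀ j, AEStronglyMeasurable (fun x => f (x, j)) μ := by
  rw [prod_count_eq_sum, aestronglyMeasurable_sum_measure_iff]
  exact forall_congr' fun j =>
    (measurableEmbedding_prod_mk_right j).aestronglyMeasurable_map_iff

lemma lintegral_prod_count [Fintype ι] {f : M × ι → ENNReal}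
    (hf : ∀ j, AEMeasurable (fun x => f (x, j)) μ) :
    ∫⁻ x, f x ∂μ.prod Measure.count = ∫⁻ x, ∑ j, f (x, j) ∂μ := by
  rw [prod_count_eq_sum, lintegral_sum_measure, tsum_fintype,
    lintegral_finsetSum' _ fun j _ => hf j]
  exact Finset.sum_congr rfl fun j _ => (measurableEmbedding_prod_mk_right j).lintegral_map f

variable {𝕜 : Type*} [NormedField 𝕜] [NormedSpace 𝕜 V] {p : ENNReal}

lemma curryPiLp_ae_eq_iff [Countable ι] {f g : M × ι → V} :
    curryPiLp 𝕜 p f =ᵐ[μ] curryPiLp 𝕜 p g ↔ f =ᵐ[μ.prod Measure.count] g := by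
  rw [Filter.EventuallyEq, Filter.EventuallyEq, ae_prod_count_iff]
  simp only [PiLp.ext_iff, curryPiLp_apply]

variable [Fact (1 ≤ p)]

lemma aestronglyMeasurable_curryPiLp_iff [Finite ι] {f : M × ι → V} :
    AEStronglyMeasurable (curryPiLp 𝕜 p f) μ ↔
      AEStronglyMeasurable f (μ.prod Measure.count) := by
  rw [aestronglyMeasurable_prod_count_iff]
  refine ⟨fun h j => ?_, fun h => ?_⟩
  · exact ((continuous_apply j).comp (PiLp.continuous_ofLp p _)).comp_aestronglyMeasurable h
  · classical
    have := Fintype.ofFinite ι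
    have hsum : curryPiLp 𝕜 p f = fun x => ∑ j, WithLp.toLp p (Pi.single j (f (x, j))) := by
      funext x
      ext i
      simp [Pi.single_apply]
    rw [hsum]
    exact Finset.aestronglyMeasurable_fun_sum _ fun j _ =>
      ((PiLp.continuous_toLp p _).comp (continuous_single j)).comp_aestronglyMeasurable (h j)

variable [Fintype ι]

lemma eLpNorm_curryPiLp (hp : p ≠ ⊤) {f : M × ι → V}
    (hf : AEStronglyMeasurable f (μ.prod Measure.count)) :
    eLpNorm (curryPiLp 𝕜 p f) p μ = eLpNorm f p (μ.prod Measure.count) := by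
  have hp₀ : p ≠ 0 := (zero_lt_one.trans_le Fact.out).ne'
  have hf' := aestronglyMeasurable_prod_count_iff.1 hf
  simp only [eLpNorm_eq_lintegral_rpow_enorm_toReal hp₀ hp, enorm_rpow_eq_sum_piLp hp,
    curryPiLp_apply]
  rw [lintegral_prod_count fun j => (hf' j).enorm.pow_const _]

lemma memLp_curryPiLp_iff (hp : p ≠ ⊤) {f : M × ι → V} :
    MemLp (curryPiLp 𝕜 p f) p μ ↔ MemLp f p (μ.prod Measure.count) := by
  rw [MemLp, MemLp, aestronglyMeasurable_curryPiLp_iff]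
  exact and_congr_right fun hf => by rw [eLpNorm_curryPiLp hp hf]

variable (𝕜) in
lemma memLp_curryPiLp (hp : p ≠ ⊤) (u : Lp V p (μ.prod (Measure.count : Measure ι))) :
    MemLp (curryPiLp 𝕜 p u) p μ :=
  (memLp_curryPiLp_iff hp).2 (Lp.memLp u)

variable (𝕜) in
lemma memLp_curryPiLp_symm (hp : p ≠ ⊤) (v : Lp (PiLp p fun _ : ι => V) p μ) :
    MemLp ((curryPiLp 𝕜 p).symm v) p (μ.prod Measure.count) :=
  (memLp_curryPiLp_iff (𝕜 := 𝕜) hp).1 (Lp.memLp v)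

variable (𝕜) in
/-- Currying, as an isometry from `Lᵖ(M × ι; V)` onto `Lᵖ(M; V^ι)`. -/
def curryLp (hp : p ≠ ⊤) :
    Lp V p (μ.prod (Measure.count : Measure ι)) ≃ₗᵢ[𝕜] Lp (PiLp p fun _ : ι => V) p μ where
  toFun u := (memLp_curryPiLp 𝕜 hp u).toLp
  invFun v := (memLp_curryPiLp_symm 𝕜 hp v).toLp
  map_add' u v := MemLp.toLp_congr _ ((memLp_curryPiLp 𝕜 hp u).add (memLp_curryPiLp 𝕜 hp v))
    (curryPiLp_ae_eq_iff.2 (Lp.coeFn_add u v))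
  map_smul' c u := MemLp.toLp_congr _ ((memLp_curryPiLp 𝕜 hp u).const_smul c)
    (curryPiLp_ae_eq_iff.2 (Lp.coeFn_smul c u))
  left_inv u := Lp.ext ((MemLp.coeFn_toLp _).trans
    ((curryPiLp_ae_eq_iff (𝕜 := 𝕜)).1 (MemLp.coeFn_toLp (memLp_curryPiLp 𝕜 hp u))))
  right_inv v := Lp.ext ((MemLp.coeFn_toLp _).trans
    ((curryPiLp_ae_eq_iff (𝕜 := 𝕜)).2 (MemLp.coeFn_toLp (memLp_curryPiLp_symm 𝕜 hp v))))
  norm_map' u := by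
    change ‖(memLp_curryPiLp 𝕜 hp u).toLp‖ = ‖u‖
    rw [Lp.norm_toLp, Lp.norm_def, eLpNorm_curryPiLp hp (Lp.aestronglyMeasurable u)]

lemma curryLp_ae_eq_iff (hp : p ≠ ⊤) {u : Lp V p (μ.prod (Measure.count : Measure ι))}
    {f : M × ι → V} :
    curryLp 𝕜 hp u =ᵐ[μ] curryPiLp 𝕜 p f ↔ u =ᵐ[μ.prod Measure.count] f := by
  rw [← curryPiLp_ae_eq_iff (𝕜 := 𝕜) (p := p)]
  have h : curryLp 𝕜 hp u =ᵐ[μ] curryPiLp 𝕜 p u :=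
    MemLp.coeFn_toLp (memLp_curryPiLp 𝕜 hp u)
  exact ⟨h.symm.trans, h.trans⟩

end Curry

section CurryClosure

variable {M ι V : Type*} [NormedAddCommGroup V] [InnerProductSpace ℂ V] [Fintype ι]
  [MeasurableSpace M] [MeasurableSpace ι] [MeasurableSingletonClass ι] {μ : Measure M} [SFinite μ]

lemma unitarilyEquivalent_l2Closure_curryPiLp {S : Submodule ℂ (M × ι → V)}
    {L : S →ₗ[ℂ] (M × ι → V)} {S' : Submodule ℂ (M → PiLp 2 fun _ : ι => V)}
    {L' : S' →ₗ[ℂ] (M → PiLp 2 fun _ : ι => V)} (hS : ∀ f, curryPiLp ℂ 2 f ∈ S' ↔ f ∈ S)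
    (hL : ∀ (f : S) (h : curryPiLp ℂ 2 f ∈ S'), L' ⟨_, h⟩ = curryPiLp ℂ 2 (L f)) :
    UnitarilyEquivalent (l2Closure (μ.prod Measure.count) S L) (l2Closure μ S' L') := by
  have hT (u : Lp V 2 (μ.prod (Measure.count : Measure ι))) (f : M × ι → V) :
      curryLp ℂ ENNReal.ofNat_ne_top u =ᵐ[μ] curryPiLp ℂ 2 f ↔ u =ᵐ[μ.prod Measure.count] f :=
    curryLp_ae_eq_iff _
  refine ⟨curryLp ℂ ENNReal.ofNat_ne_top, intertwines_l2Closure fun u v => ⟨?_, ?_⟩⟩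
  · rintro ⟨⟨f', hf'⟩, hu, hv⟩
    obtain ⟨f, rfl⟩ := (curryPiLp ℂ 2).surjective f'
    rw [hL ⟨f, (hS f).1 hf'⟩] at hv
    exact ⟨⟨f, (hS f).1 hf'⟩, (hT u f).1 hu, (hT v _).1 hv⟩
  · rintro ⟨f, hu, hv⟩
    have hf := (hS f).2 f.2
    exact ⟨⟨_, hf⟩, (hT u f).2 hu, hL f hf ▸ (hT v _).2 hv⟩

end CurryClosure

/-! ### Conformal covariance of the Laplacian -/

section Conformal

variable {V : Type*} [NormedAddCommGroup V] [NormedSpace ℝ V]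

lemma fderiv_comp_holomorphic_apply {f : ℂ → V} {g : ℂ → ℂ} {z : ℂ}
    (hf : DifferentiableAt ℝ f (g z)) (hg : DifferentiableAt ℂ g z) (v : ℂ) :
    fderiv ℝ (f ∘ g) z v = fderiv ℝ f (g z) (deriv g z * v) := by
  rw [(hf.hasFDerivAt.comp z hg.hasDerivAt.complexToReal_fderiv).fderiv]
  rfl

lemma iteratedFDeriv_two_apply_self {f : ℂ → V} {z : ℂ} (hf : ContDiffAt ℝ 2 f z) (v : ℂ) :
    iteratedFDeriv ℝ 2 f z ![v, v] = fderiv ℝ (fun w => fderiv ℝ f w v) z v := by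
  have hf' : DifferentiableAt ℝ (fderiv ℝ f) z :=
    (hf.fderiv_right (m := 1) le_rfl).differentiableAt one_ne_zero
  rw [iteratedFDeriv_two_apply, fderiv_clm_apply hf' (differentiableAt_const v)]
  simp

lemma iteratedFDeriv_two_comp_holomorphic {f : ℂ → V} {g : ℂ → ℂ} {z : ℂ}
    (hf : ContDiffAt ℝ 2 f (g z)) (hg : AnalyticAt ℂ g z) (v : ℂ) :
    iteratedFDeriv ℝ 2 (f ∘ g) z ![v, v] =
      iteratedFDeriv ℝ 2 f (g z) ![deriv g z * v, deriv g z * v] +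
        fderiv ℝ f (g z) (deriv (deriv g) z * v * v) := by
  have hfg : ContDiffAt ℝ 2 (f ∘ g) z := hf.comp z (hg.contDiffAt.restrict_scalars ℝ)
  have hfirst : (fun w => fderiv ℝ (f ∘ g) w v) =ᶠ[nhds z]
      fun w => fderiv ℝ f (g w) (deriv g w * v) := by
    have hf_near := hg.continuousAt.eventually (hf.eventually (by simp))
    filter_upwards [hf_near, hg.eventually_analyticAt] with w hfw hgw
    exact fderiv_comp_holomorphic_apply (hfw.differentiableAt two_ne_zero) hgw.differentiableAt v
  have hf' : HasFDerivAt (fderiv ℝ f) (fderiv ℝ (fderiv ℝ f) (g z)) (g z) :=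
    ((hf.fderiv_right (m := 1) le_rfl).differentiableAt one_ne_zero).hasFDerivAt
  have hg' := hg.differentiableAt.hasDerivAt.complexToReal_fderiv
  have hg'' := hg.deriv.differentiableAt.hasDerivAt.complexToReal_fderiv.mul_const' v
  have hsecond : HasFDerivAt (fun w => fderiv ℝ f (g w) (deriv g w * v)) _ z :=
    (hf'.comp z hg').clm_apply hg''
  rw [iteratedFDeriv_two_apply_self hfg, hfirst.fderiv_eq, hsecond.fderiv,
    iteratedFDeriv_two_apply, add_comm]
  simp [mul_comm v]

lemma bilin_apply_mul_add_apply_mul_I (B : ℂ →L[ℝ] ℂ →L[ℝ] V) (a : ℂ) :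
    B a a + B (a * Complex.I) (a * Complex.I) =
      ‖a‖ ^ 2 • (B 1 1 + B Complex.I Complex.I) := by
  have ha : a = a.re • (1 : ℂ) + a.im • Complex.I := by simp
  have haI : a * Complex.I = (-a.im) • (1 : ℂ) + a.re • Complex.I := by
    apply Complex.ext <;> simp
  rw [haI, ← Complex.normSq_eq_norm_sq, Complex.normSq_apply]
  nth_rewrite 1 2 [ha]
  simp only [map_add, map_smul, _root_.add_apply, _root_.smul_apply]
  module

lemma laplacian_comp_holomorphic {f : ℂ → V} {g : ℂ → ℂ} {z : ℂ}
    (hf : ContDiffAt ℝ 2 f (g z)) (hg : AnalyticAt ℂ g z) :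
    Laplacian.laplacian (f ∘ g) z = ‖deriv g z‖ ^ 2 • Laplacian.laplacian f (g z) := by
  have htrace := bilin_apply_mul_add_apply_mul_I (fderiv ℝ (fderiv ℝ f) (g z)) (deriv g z)
  have hderiv₂ : fderiv ℝ f (g z) (deriv (deriv g) z) +
      fderiv ℝ f (g z) (deriv (deriv g) z * Complex.I * Complex.I) = 0 := by
    rw [mul_assoc, Complex.I_mul_I, mul_neg_one, map_neg, add_neg_cancel]
  simp only [InnerProductSpace.laplacian_eq_iteratedFDeriv_complexPlane,
    iteratedFDeriv_two_comp_holomorphic hf hg, mul_one]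
  rw [add_add_add_comm, hderiv₂, add_zero]
  simpa only [iteratedFDeriv_two_apply, Matrix.cons_val_zero, Matrix.cons_val_one] using htrace

end Conformal

section HyperbolicLaplacian

variable {V : Type*} [NormedAddCommGroup V] [InnerProductSpace ℂ V] {ψ : ℍ → V}

lemma im_smul_sq_eq {g : GL (Fin 2) ℝ} (hg : 0 < g.val.det) (z : ℍ) :
    (g • z).im ^ 2 = z.im ^ 2 * ‖deriv (fun w : ℂ => ((g • ofComplex w : ℍ) : ℂ)) z‖ ^ 2 := by
  have hdenom : ‖denom g z‖ ≠ 0 := norm_ne_zero_iff.2 (denom_ne_zero g z)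
  rw [deriv_smul hg, im_smul_eq_div_normSq, Complex.normSq_eq_norm_sq, norm_div, norm_pow,
    Complex.norm_real, Real.norm_eq_abs]
  simp only [Matrix.GeneralLinearGroup.val_det_apply]
  field_simp

lemma hypLaplacian_comp_smul_GL (hψ : IsSmooth ψ) {g : GL (Fin 2) ℝ} (hg : 0 < g.val.det)
    (z : ℍ) : hypLaplacian (fun w => ψ (g • w)) z = hypLaplacian ψ (g • z) := by
  have hcomp : (fun w : ℂ => ψ (g • ofComplex w)) =
      (fun w : ℂ => ψ (ofComplex w)) ∘ fun w : ℂ => ((g • ofComplex w : ℍ) : ℂ) := by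
    funext w
    simp only [Function.comp_apply, ofComplex_apply]
  have hz : ((g • ofComplex (z : ℂ) : ℍ) : ℂ) = ((g • z : ℍ) : ℂ) := by rw [ofComplex_apply]
  have hsmooth : ContDiffAt ℝ 2 (fun w : ℂ => ψ (ofComplex w)) ((g • ofComplex (z : ℂ) : ℍ) : ℂ) :=
    hz ▸ hψ.contDiffAt (g • z)
  rw [hypLaplacian, hypLaplacian, hcomp,
    laplacian_comp_holomorphic (g := fun w : ℂ => ((g • ofComplex w : ℍ) : ℂ)) hsmooth
      (analyticAt_smul hg z), hz, smul_smul, im_smul_sq_eq hg]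

lemma hypLaplacian_comp_smul (hψ : IsSmooth ψ) (g : PSL(2, ℝ)) (z : ℍ) :
    hypLaplacian (fun w => ψ (g • w)) z = hypLaplacian ψ (g • z) := by
  induction g using QuotientGroup.induction_on with
  | H g =>
    have hg : 0 < (Matrix.SpecialLinearGroup.mapGL ℝ g : GL (Fin 2) ℝ).val.det := by simp
    exact hypLaplacian_comp_smul_GL hψ hg z

lemma hypLaplacian_clm_comp {W : Type*} [NormedAddCommGroup W] [InnerProductSpace ℂ W]
    (hψ : IsSmooth ψ) (L : V →L[ℂ] W) (z : ℍ) :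
    hypLaplacian (fun w => L (ψ w)) z = L (hypLaplacian ψ z) := by
  have h : Laplacian.laplacian (fun w : ℂ => L (ψ (ofComplex w))) z =
      L (Laplacian.laplacian (fun w : ℂ => ψ (ofComplex w)) z) :=
    (hψ.contDiffAt z).laplacian_CLM_comp_left (l := L.restrictScalars ℝ)
  rw [hypLaplacian, hypLaplacian, h, map_neg]
  exact congrArg _ ((L.restrictScalars ℝ).map_smul _ _).symm

end HyperbolicLaplacian

section PSL

instance : MeasurableConstSMul PSL(2, ℝ) ℍ where
  measurable_const_smul g := by
    induction g using QuotientGroup.induction_on with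
    | H g => exact (continuous_const_smul g : Continuous fun z : ℍ => g • z).measurable

instance : SMulInvariantMeasure PSL(2, ℝ) ℍ volume where
  measure_preimage_smul g s hs := by
    induction g using QuotientGroup.induction_on with
    | H g =>
      exact SMulInvariantMeasure.measure_preimage_smul (μ := (volume : Measure ℍ))
        (Matrix.SpecialLinearGroup.mapGL ℝ g) hs

instance : SecondCountableTopology PSL(2, ℝ) := by
  have : SecondCountableTopology SL(2, ℝ) :=
    have : SecondCountableTopology (Matrix (Fin 2) (Fin 2) ℝ) :=
      inferInstanceAs (SecondCountableTopology (Fin 2 → Fin 2 → ℝ))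
    Matrix.SpecialLinearGroup.isClosedEmbedding_val.isEmbedding.secondCountableTopology
  exact inferInstanceAs (SecondCountableTopology (SL(2, ℝ) ⧸ Subgroup.center SL(2, ℝ)))

lemma IsCompactSurfaceGroup.countable {Γ : Subgroup PSL(2, ℝ)} (hΓ : IsCompactSurfaceGroup Γ) :
    Countable Γ :=
  have := hΓ.discrete
  countable_of_Lindelof_of_discrete

end PSL

/-! ### Induced and permutation representations -/

section InducedRepresentation

open MulAction Representation TensorProduct
open scoped MonoidAlgebra DirectSum

variable {k G V : Type*} [CommRing k] [Group G] [AddCommGroup V] [Module k V]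

section UniversalProperty

variable {H W : Type*} [Group H] (φ : H →* G) (τ : Representation k H V)
  [AddCommGroup W] [Module k W]

lemma indV_mk_map_mul (s : H) (g : G) (v : V) :
    IndV.mk φ τ (φ s * g) (τ s v) = IndV.mk φ τ g v := by
  simpa using Coinvariants.mk_self_apply
    (Representation.tprod (MonoidHom.comp (leftRegular k G) φ) τ) s
    (MonoidAlgebra.single g (1 : k) ⊗ₜ[k] v)

lemma basis_constr_single {α M : Type*} [AddCommMonoid M] [Module k M] (f : α → M) (a : α) :
    (MonoidAlgebra.basis α k).constr k f (.single a 1) = f a :=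
  Module.Basis.constr_basis ..

/-- The linear map on an induced module with prescribed values on the generators `⟦g ⊗ v⟧`. -/
def indLift (f : G → V →ₗ[k] W) (hf : ∀ s g v, f (φ s * g) (τ s v) = f g v) : IndV φ τ →ₗ[k] W :=
  Coinvariants.lift _ (TensorProduct.lift ((MonoidAlgebra.basis G k).constr k f)) fun s => by
    refine TensorProduct.ext <| (MonoidAlgebra.basis G k).ext fun g => LinearMap.ext fun v => ?_
    simp [basis_constr_single, hf]

lemma indLift_mk (f : G → V →ₗ[k] W) (hf : ∀ s g v, f (φ s * g) (τ s v) = f g v) (g : G)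
    (v : V) : indLift φ τ f hf (IndV.mk φ τ g v) = f g v := by
  simp [indLift, basis_constr_single]

end UniversalProperty

variable {X : Type*} [MulAction G X] (σ : Representation k G V)

lemma tensor_monoidAlgebra_hom_ext {W : Type*} [AddCommMonoid W] [Module k W]
    {f f' : V ⊗[k] k[X] →ₗ[k] W}
    (h : ∀ v x, f (v ⊗ₜ .single x 1) = f' (v ⊗ₜ .single x 1)) : f = f' :=
  TensorProduct.ext <| LinearMap.ext fun v => (MonoidAlgebra.basis X k).ext fun x => h v x

/-- The restriction of `σ` to the stabilizer of `x`. -/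
abbrev stabilizerRes (x : X) : Representation k (stabilizer G x) V :=
  MonoidHom.comp σ (stabilizer G x).subtype

/-- The space of the representation of `G` induced from the restriction of `σ` to the stabilizer
of `x`. -/
abbrev StabilizerIndV (x : X) := IndV (stabilizer G x).subtype (stabilizerRes σ x)

/-- The generator `⟦g⁻¹ ⊗ σ(g⁻¹) v⟧` of the induced representation, which corresponds to the vector
`v` over the point `gx` of the orbit of `x`. -/
def stabilizerIndMk (x : X) (g : G) : V →ₗ[k] StabilizerIndV σ x := IndV.mk _ _ g⁻¹ ∘ₗ σ g⁻¹

lemma stabilizerIndMk_apply (x : X) (g : G) (v : V) :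
    stabilizerIndMk σ x g v = IndV.mk _ _ g⁻¹ (σ g⁻¹ v) := rfl

lemma stabilizerIndMk_eq {x : X} {g g' : G} (h : g • x = g' • x) :
    stabilizerIndMk σ x g = stabilizerIndMk σ x g' := by
  ext1 v
  have hs : g'⁻¹ * g ∈ stabilizer G x := by
    rw [mem_stabilizer_iff, mul_smul, h, inv_smul_smul]
  have hσ : σ (g'⁻¹ * g) (σ g⁻¹ v) = σ g'⁻¹ v := by
    rw [← Module.End.mul_apply, ← map_mul, mul_inv_cancel_right]
  have := indV_mk_map_mul (stabilizer G x).subtype (stabilizerRes σ x) ⟨_, hs⟩ g⁻¹ (σ g⁻¹ v)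
  simpa only [stabilizerIndMk_apply, Subgroup.subtype_apply, mul_inv_cancel_right,
    MonoidHom.comp_apply, hσ] using this.symm

lemma indV_mk_eq_stabilizerIndMk (x : X) (g : G) (v : V) :
    IndV.mk (stabilizer G x).subtype (stabilizerRes σ x) g v =
      stabilizerIndMk σ x g⁻¹ (σ g⁻¹ v) := by
  rw [stabilizerIndMk_apply, inv_inv, self_inv_apply]

lemma stabilizerInd_hom_ext {x : X} {W : Type*} [AddCommGroup W] [Module k W]
    {f f' : StabilizerIndV σ x →ₗ[k] W}
    (h : ∀ g v, f (stabilizerIndMk σ x g v) = f' (stabilizerIndMk σ x g v)) : f = f' :=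
  IndV.hom_ext _ _ fun g => LinearMap.ext fun v => by
    have := h g⁻¹ (σ g⁻¹ v)
    rwa [← indV_mk_eq_stabilizerIndMk] at this

lemma ind_stabilizerIndMk (x : X) (a g : G) (v : V) :
    ind (stabilizer G x).subtype (stabilizerRes σ x) a (stabilizerIndMk σ x g v) =
      stabilizerIndMk σ x (a * g) (σ a v) := by
  rw [stabilizerIndMk_apply, ind_mk, indV_mk_eq_stabilizerIndMk]
  simp [← Module.End.mul_apply, ← map_mul, mul_assoc]

/-- The projection formula for one orbit: the generator over the point `gx` with vector `v` is sent
to `v ⊗ gx`. -/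
def stabilizerIndToTensor (x : X) : StabilizerIndV σ x →ₗ[k] V ⊗[k] k[X] :=
  indLift _ _ (fun g => (TensorProduct.mk k V k[X]).flip (.single (g⁻¹ • x) 1) ∘ₗ σ g⁻¹) (by
    intro s g v
    have hx : (s * g : G)⁻¹ • x = g⁻¹ • x := by
      rw [mul_inv_rev, mul_smul, inv_smul_eq_iff.2 (mem_stabilizer_iff.1 s.2).symm]
    have hσ : σ (s * g : G)⁻¹ (σ s v) = σ g⁻¹ v := by
      rw [← Module.End.mul_apply, ← map_mul, mul_inv_rev, inv_mul_cancel_right]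
    simp only [Subgroup.subtype_apply, LinearMap.comp_apply, MonoidHom.comp_apply, hx, hσ])

lemma stabilizerIndToTensor_mk (x : X) (g : G) (v : V) :
    stabilizerIndToTensor σ x (stabilizerIndMk σ x g v) = v ⊗ₜ .single (g • x) 1 := by
  rw [stabilizerIndMk_apply, stabilizerIndToTensor, indLift_mk, LinearMap.comp_apply, inv_inv,
    self_inv_apply, LinearMap.flip_apply, TensorProduct.mk_apply]

open Classical in
/-- Uniqueness of the representative `r` of an orbit makes the image of `v ⊗ gr` independent of the
choice of `g`. -/
lemma exists_tensorToDirectSum {R : Set X} (hR : ∀ x, ∃! r, r ∈ R ∧ ∃ g : G, g • r = x) :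
    ∃ T : V ⊗[k] k[X] →ₗ[k] ⨁ r : R, StabilizerIndV σ (r : X),
      ∀ (r : R) (g : G) (v : V), T (v ⊗ₜ .single (g • (r : X)) 1) =
        DirectSum.lof k R (fun r : R => StabilizerIndV σ (r : X)) r
          (stabilizerIndMk σ (r : X) g v) := by
  choose r hr r_unique using hR
  choose r_mem g hg using hr
  let f (x : X) := DirectSum.lof k R (fun r : R => StabilizerIndV σ (r : X)) ⟨r x, r_mem x⟩ ∘ₗ
    stabilizerIndMk σ (r x) (g x)
  refine ⟨TensorProduct.lift ((MonoidAlgebra.basis X k).constr k f).flip, ?_⟩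
  rintro ⟨s, hs⟩ h v
  rw [TensorProduct.lift.tmul, LinearMap.flip_apply, basis_constr_single]
  have hsr : s = r (h • s) := r_unique _ _ ⟨hs, h, rfl⟩
  generalize hx : h • s = x at hsr ⊢
  subst hsr
  rw [← stabilizerIndMk_eq σ ((hg x).trans hx.symm)]
  rfl

theorem nonempty_tprod_equiv_directSum_ind {R : Set X}
    (hR : ∀ x, ∃! r, r ∈ R ∧ ∃ g : G, g • r = x) :
    Nonempty ((Representation.tprod σ (ofMulAction k G X)).Equiv
      (Representation.directSum fun r : R =>
        ind (stabilizer G (r : X)).subtype (stabilizerRes σ (r : X)))) := by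
  classical
  obtain ⟨T, hT⟩ := exists_tensorToDirectSum σ hR
  let S := DirectSum.toModule k R _ fun r : R => stabilizerIndToTensor σ (r : X)
  have hS (r : R) (g : G) (v : V) : S (DirectSum.lof k R _ r (stabilizerIndMk σ (r : X) g v)) =
      v ⊗ₜ .single (g • (r : X)) 1 := by
    rw [DirectSum.toModule_lof, stabilizerIndToTensor_mk]
  have hST : S ∘ₗ T = LinearMap.id := tensor_monoidAlgebra_hom_ext fun v x => by
    obtain ⟨r, ⟨hr, g, rfl⟩, -⟩ := hR x
    rw [LinearMap.comp_apply, hT ⟨r, hr⟩, hS, LinearMap.id_apply]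
  have hTS : T ∘ₗ S = LinearMap.id :=
    DirectSum.linearMap_ext _ fun r => stabilizerInd_hom_ext σ fun g v => by
      simp only [LinearMap.comp_apply, LinearMap.id_apply, hS, hT]
  refine ⟨.mk (LinearEquiv.ofLinearMap T S hTS hST) fun a => ?_⟩
  refine tensor_monoidAlgebra_hom_ext fun v x => ?_
  obtain ⟨r, ⟨hr, g, rfl⟩, -⟩ := hR x
  rw [LinearMap.comp_apply, LinearMap.comp_apply, LinearEquiv.coe_coe, LinearEquiv.coe_ofLinearMap,
    Representation.tprod_apply, TensorProduct.map_tmul, ofMulAction_single, smul_smul,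
    hT ⟨r, hr⟩, hT ⟨r, hr⟩, directSum_apply, DirectSum.lmap_lof]
  exact congrArg _ (ind_stabilizerIndMk σ r a g v).symm

lemma trace_ofMulAction [Finite X] (g : G) :
    LinearMap.trace k k[X] (ofMulAction k G X g) = ((fixedBy X g).ncard : k) := by
  classical
  have := Fintype.ofFinite X
  have hdiag (x : X) : LinearMap.toMatrix (MonoidAlgebra.basis X k) (MonoidAlgebra.basis X k)
      (ofMulAction k G X g) x x = if g • x = x then 1 else 0 := by
    simp [LinearMap.toMatrix_apply, MonoidAlgebra.basis, Finsupp.single_apply]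
  have hfixed : fixedBy X g = ({x | g • x = x} : Finset X) := by
    ext x
    simp
  rw [LinearMap.trace_eq_matrix_trace k (MonoidAlgebra.basis X k), Matrix.trace, hfixed,
    Set.ncard_coe_finset, ← Finset.sum_boole]
  exact Finset.sum_congr rfl fun x _ => hdiag x

end InducedRepresentation

section PermutationRepresentation

open MulAction Representation TensorProduct
open scoped MonoidAlgebra

variable {G ι V : Type*} [Group G] [MulAction G ι] [Fintype ι]
  [NormedAddCommGroup V] [InnerProductSpace ℂ V] (ρ : G →* (V ≃ₗᵢ[ℂ] V))

variable (ι) in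
/-- The unitary representation `(ϱ(g) v)_{gj} = ρ(g) v_j` of `G` on the orthogonal direct sum of
copies of `V` indexed by a `G`-set. -/
def permRep : G →* (PiLp 2 (fun _ : ι => V) ≃ₗᵢ[ℂ] PiLp 2 (fun _ : ι => V)) where
  toFun g := (LinearIsometryEquiv.piLpCongrRight 2 fun _ => ρ g).trans
    (LinearIsometryEquiv.piLpCongrLeft 2 ℂ V (MulAction.toPerm g))
  map_one' := by
    ext v j
    simp
  map_mul' a b := by
    ext v j
    simp [mul_smul]

lemma permRep_apply_smul (g : G) (v : PiLp 2 (fun _ : ι => V)) (j : ι) :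
    permRep ι ρ g v (g • j) = ρ g (v j) := by
  simp [permRep]

lemma rank_piLp {ι : Type} [Fintype ι] :
    Module.rank ℂ (PiLp 2 fun _ : ι => V) = Fintype.card ι * Module.rank ℂ V := by
  rw [(WithLp.linearEquiv 2 ℂ (ι → V)).rank_eq, rank_fun_eq_lift_mul, Cardinal.lift_uzero]

open Classical in
variable (ι) in
/-- The identification of `V ⊗ ℂ[ι]` with `Vⁱ` sending `v ⊗ j` to the vector `v` in the
`j`-th summand. -/
def tensorEquivPiLp : V ⊗[ℂ] ℂ[ι] ≃ₗ[ℂ] PiLp 2 fun _ : ι => V :=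
  equivFinsuppOfBasisRight (MonoidAlgebra.basis ι ℂ) ≪≫ₗ Finsupp.linearEquivFunOnFinite ℂ V ι ≪≫ₗ
    (WithLp.linearEquiv 2 ℂ (ι → V)).symm

open Classical in
lemma tensorEquivPiLp_tmul_single (v : V) (i j : ι) :
    tensorEquivPiLp ι (v ⊗ₜ .single i 1) j = if i = j then v else 0 := by
  simp [tensorEquivPiLp, MonoidAlgebra.basis, eq_comm]

variable (ι) in
/-- The tensor product of `ρ` with the permutation representation `ℂ[ι]` is `permRep ι ρ`. -/
def tprodEquivPermRep :
    (Representation.tprod (toRep ρ) (ofMulAction ℂ G ι)).Equiv (toRep (permRep ι ρ)) :=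
  .mk (tensorEquivPiLp ι) fun g => by
    classical
    refine tensor_monoidAlgebra_hom_ext fun v i => PiLp.ext fun j => ?_
    obtain ⟨j, rfl⟩ := MulAction.surjective g j
    change tensorEquivPiLp ι
        (Representation.tprod (toRep ρ) (ofMulAction ℂ G ι) g (v ⊗ₜ .single i 1)) (g • j) =
      permRep ι ρ g (tensorEquivPiLp ι (v ⊗ₜ .single i 1)) (g • j)
    rw [permRep_apply_smul, Representation.tprod_apply, TensorProduct.map_tmul, ofMulAction_single,
      tensorEquivPiLp_tmul_single, tensorEquivPiLp_tmul_single, apply_ite (ρ g), map_zero]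
    simp only [smul_left_cancel_iff]
    rfl

theorem trace_permRep [FiniteDimensional ℂ V] (g : G) :
    LinearMap.trace ℂ _ (toRep (permRep ι ρ) g) =
      LinearMap.trace ℂ V (toRep ρ g) * ((fixedBy ι g).ncard : ℂ) := by
  change (toRep (permRep ι ρ)).character g = _
  rw [← Representation.char_iso (tprodEquivPermRep ι ρ), Representation.char_tensor, Pi.mul_apply,
    Representation.character, Representation.character, trace_ofMulAction]

theorem nonempty_permRep_equiv_directSum_ind {R : Set ι}
    (hR : ∀ i, ∃! r, r ∈ R ∧ ∃ g : G, g • r = i) :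
    Nonempty ((toRep (permRep ι ρ)).Equiv (Representation.directSum fun r : R =>
      ind (stabilizer G (r : ι)).subtype (stabilizerRes (toRep ρ) (r : ι)))) :=
  (nonempty_tprod_equiv_directSum_ind (toRep ρ) hR).map (tprodEquivPermRep ι ρ).symm.trans

end PermutationRepresentation

/-! ### The twisted Laplacian of the cover -/

section Cover

variable {Γ : Subgroup PSL(2, ℝ)} {n : ℕ} (φ : Γ →* Equiv.Perm (Fin n))

lemma measurableConstSMul_coverAction :
    letI := coverAction φ
    MeasurableConstSMul Γ (ℍ × Fin n) :=
  let := coverAction φ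
  ⟨fun γ => ((measurable_const_smul γ).comp measurable_fst).prodMk
    ((measurable_of_finite (φ γ)).comp measurable_snd)⟩

lemma measurePreserving_perm_count {ι : Type*} [Finite ι] [MeasurableSpace ι]
    [MeasurableSingletonClass ι] (σ : Equiv.Perm ι) :
    MeasurePreserving σ Measure.count Measure.count := by
  refine ⟨measurable_of_finite σ, Measure.ext fun s hs => ?_⟩
  rw [Measure.map_apply (measurable_of_finite σ) hs, ← Equiv.image_symm_eq_preimage]
  exact Measure.count_injective_image σ.symm.injective s

lemma smulInvariantMeasure_coverAction :
    letI := coverAction φ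
    SMulInvariantMeasure Γ (ℍ × Fin n) (coverVolume n) :=
  let := coverAction φ
  ⟨fun γ _ hs => ((measurePreserving_smul γ (volume : Measure ℍ)).prod
    (measurePreserving_perm_count (φ γ))).measure_preimage hs.nullMeasurableSet⟩

lemma coverVolume_restrict_prod_univ (F : Set ℍ) :
    (coverVolume n).restrict (F ×ˢ Set.univ) = (volume.restrict F).prod Measure.count := by
  rw [coverVolume, ← Measure.prod_restrict, Measure.restrict_univ]

lemma isCoverFundamentalDomain_prod_univ {F : Set ℍ} (hF : IsFundamentalDomain Γ F) :
    IsCoverFundamentalDomain φ (F ×ˢ Set.univ) := by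
  let := coverAction φ
  rw [Set.prod_univ]
  exact hF.preimage_of_equiv Measure.quasiMeasurePreserving_fst Function.bijective_id
    fun _ _ => rfl

variable {V : Type*} [NormedAddCommGroup V] [InnerProductSpace ℂ V] (ρ : Γ →* (V ≃ₗᵢ[ℂ] V))

/-- The unitary representation `ϱ_n` of `Γ` on `Vⁿ`: the tensor product of `ρ` with the permutation
representation of `φ`. -/
def coverRep : Γ →* (PiLp 2 (fun _ : Fin n => V) ≃ₗᵢ[ℂ] PiLp 2 (fun _ : Fin n => V)) :=
  letI := MulAction.compHom (Fin n) φ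
  permRep (Fin n) ρ

lemma coverRep_apply (γ : Γ) (v : PiLp 2 (fun _ : Fin n => V)) (j : Fin n) :
    coverRep φ ρ γ v (φ γ j) = ρ γ (v j) :=
  letI := MulAction.compHom (Fin n) φ
  permRep_apply_smul ρ γ v j

lemma trace_coverRep [FiniteDimensional ℂ V] (γ : Γ) :
    LinearMap.trace ℂ _ (toRep (coverRep φ ρ) γ) =
      LinearMap.trace ℂ V (toRep ρ γ) * ((Function.fixedPoints (φ γ)).ncard : ℂ) :=
  letI := MulAction.compHom (Fin n) φ
  trace_permRep ρ γ

lemma nonempty_coverRep_equiv_inducedRep {R : Set (Fin n)} (hR : IsOrbitTransversal φ R) :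
    Nonempty ((toRep (coverRep φ ρ)).Equiv (inducedRep φ ρ R)) :=
  letI := MulAction.compHom (Fin n) φ
  nonempty_permRep_equiv_directSum_ind ρ hR

variable {φ ρ}

lemma curryPiLp_mem_sections_iff (ψ : ℍ × Fin n → V) :
    curryPiLp ℂ 2 ψ ∈ sections (coverRep φ ρ) ↔ ψ ∈ coverSections φ ρ := by
  refine and_congr (contDiffOn_piLp 2) (forall_congr' fun γ => forall_congr' fun z => ?_)
  rw [PiLp.ext_iff, ← (φ γ).forall_congr_right]
  simp only [coverRep_apply, curryPiLp_apply]

lemma sectionsLaplacian_curryPiLp (ψ : coverSections φ ρ)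
    (h : curryPiLp ℂ 2 (ψ : ℍ × Fin n → V) ∈ sections (coverRep φ ρ)) :
    sectionsLaplacian (coverRep φ ρ) ⟨_, h⟩ = curryPiLp ℂ 2 (coverSectionsLaplacian φ ρ ψ) :=
  funext fun z => PiLp.ext fun j =>
    (hypLaplacian_clm_comp h.1 (PiLp.proj 2 (fun _ : Fin n => V) j) z).symm

variable (φ ρ) in
theorem unitarilyEquivalent_coverLaplacian_prod_univ (F : Set ℍ) :
    UnitarilyEquivalent (coverLaplacian φ ρ (F ×ˢ Set.univ))
      (twistedLaplacian (coverRep φ ρ) F) := by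
  rw [coverLaplacian, coverVolume_restrict_prod_univ]
  exact unitarilyEquivalent_l2Closure_curryPiLp curryPiLp_mem_sections_iff
    sectionsLaplacian_curryPiLp

lemma coverSectionsLaplacian_smul (ψ : coverSections φ ρ) (γ : Γ) (z : ℍ) (j : Fin n) :
    coverSectionsLaplacian φ ρ ψ (γ • z, φ γ j) = ρ γ (coverSectionsLaplacian φ ρ ψ (z, j)) := by
  obtain ⟨ψ, hψ, hψγ⟩ := ψ
  calc hypLaplacian (fun w => ψ (w, φ γ j)) ((γ : PSL(2, ℝ)) • z)
    _ = hypLaplacian (fun w => ψ ((γ : PSL(2, ℝ)) • w, φ γ j)) z :=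
      (hypLaplacian_comp_smul (hψ (φ γ j)) γ z).symm
    _ = hypLaplacian (fun w => ρ γ (ψ (w, j))) z :=
      congrArg (hypLaplacian · z) (funext fun w => hψγ γ w j)
    _ = ρ γ (hypLaplacian (fun w => ψ (w, j)) z) :=
      hypLaplacian_clm_comp (hψ j) (ρ γ).toContinuousLinearEquiv.toContinuousLinearMap z

variable (ρ) in
theorem unitarilyEquivalent_coverLaplacian [Countable Γ] {D D' : Set (ℍ × Fin n)}
    (hD : IsCoverFundamentalDomain φ D) (hD' : IsCoverFundamentalDomain φ D') :
    UnitarilyEquivalent (coverLaplacian φ ρ D) (coverLaplacian φ ρ D') := by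
  let := coverAction φ
  have := measurableConstSMul_coverAction φ
  have := smulInvariantMeasure_coverAction φ
  exact unitarilyEquivalent_l2Closure_restrict hD hD' (ϱ := ρ)
    (fun ψ hψ γ p => hψ.2 γ p.1 p.2) fun ψ γ p => coverSectionsLaplacian_smul ψ γ p.1 p.2

variable (ρ) in
theorem unitarilyEquivalent_coverLaplacian_twistedLaplacian [Countable Γ] {F : Set ℍ}
    {D : Set (ℍ × Fin n)} (hF : IsFundamentalDomain Γ F) (hD : IsCoverFundamentalDomain φ D) :
    UnitarilyEquivalent (coverLaplacian φ ρ D) (twistedLaplacian (coverRep φ ρ) F) :=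
  (unitarilyEquivalent_coverLaplacian ρ hD (isCoverFundamentalDomain_prod_univ φ hF)).trans
    (unitarilyEquivalent_coverLaplacian_prod_univ φ ρ F)

end Cover

end TwistedLaplacian

end

open TwistedLaplacian in
theorem mainTheorem7_general (Γ : Subgroup PSL(2, ℝ)) [Countable Γ] {V : Type*}
    [NormedAddCommGroup V] [InnerProductSpace ℂ V] (ρ : Γ →* (V ≃ₗᵢ[ℂ] V)) (n : ℕ)
    (φ : Γ →* Equiv.Perm (Fin n)) :
    ∃ ϱ : Γ →* (PiLp 2 (fun _ : Fin n => V) ≃ₗᵢ[ℂ] PiLp 2 (fun _ : Fin n => V)),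
      Module.rank ℂ (PiLp 2 (fun _ : Fin n => V)) = n * Module.rank ℂ V ∧
      (∀ R : Set (Fin n), IsOrbitTransversal φ R →
        Nonempty ((toRep ϱ).Equiv (inducedRep φ ρ R))) ∧
      (∀ (F : Set ℍ) (D : Set (ℍ × Fin n)),
        IsFundamentalDomain Γ F volume → IsCoverFundamentalDomain φ D →
        spectrum (coverLaplacian φ ρ D) = spectrum (twistedLaplacian ϱ F) ∧
          ∀ c : ℂ, Module.rank ℂ (eigenspace (coverLaplacian φ ρ D) c) =
            Module.rank ℂ (eigenspace (twistedLaplacian ϱ F) c)) ∧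
      (FiniteDimensional ℂ V → ∀ γ : Γ, LinearMap.trace ℂ _ (toRep ϱ γ) =
        LinearMap.trace ℂ V (toRep ρ γ) * ((Function.fixedPoints (φ γ)).ncard : ℂ)) := by
  refine ⟨coverRep φ ρ, by rw [rank_piLp, Fintype.card_fin],
    fun R hR => nonempty_coverRep_equiv_inducedRep φ ρ hR, fun F D hF hD => ?_,
    fun _ => trace_coverRep φ ρ⟩
  have h := unitarilyEquivalent_coverLaplacian_twistedLaplacian ρ hF hD
  exact ⟨h.spectrum_eq, h.rank_eigenspace_eq⟩

theorem mainTheorem7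
    (Γ : Subgroup PSL(2, ℝ)) (hΓ : TwistedLaplacian.IsCompactSurfaceGroup Γ)
    {V : Type*} [NormedAddCommGroup V] [InnerProductSpace ℂ V] [FiniteDimensional ℂ V]
    (ρ : Γ →* (V ≃ₗᵢ[ℂ] V)) (n : ℕ) (φ : Γ →* Equiv.Perm (Fin n)) :
    ∃ ϱ : Γ →* (PiLp 2 (fun _ : Fin n => V) ≃ₗᵢ[ℂ] PiLp 2 (fun _ : Fin n => V)),
      Module.finrank ℂ (PiLp 2 (fun _ : Fin n => V)) = n * Module.finrank ℂ V ∧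
      (∀ R : Set (Fin n), TwistedLaplacian.IsOrbitTransversal φ R →
        Nonempty ((TwistedLaplacian.toRep ϱ).Equiv (TwistedLaplacian.inducedRep φ ρ R))) ∧
      (∀ (F : Set ℍ) (D : Set (ℍ × Fin n)),
        IsCompact F → MeasureTheory.IsFundamentalDomain Γ F (MeasureTheory.volume) →
        IsCompact D → TwistedLaplacian.IsCoverFundamentalDomain φ D →
        TwistedLaplacian.spectrum (TwistedLaplacian.coverLaplacian φ ρ D) =
            TwistedLaplacian.spectrum (TwistedLaplacian.twistedLaplacian ϱ F) ∧
          ∀ c : ℂ,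
            Module.rank ℂ (TwistedLaplacian.eigenspace
                (TwistedLaplacian.coverLaplacian φ ρ D) c) =
              Module.rank ℂ (TwistedLaplacian.eigenspace
                (TwistedLaplacian.twistedLaplacian ϱ F) c)) ∧
      ∀ γ : Γ,
        LinearMap.trace ℂ _ (TwistedLaplacian.toRep ϱ γ) =
          LinearMap.trace ℂ V (TwistedLaplacian.toRep ρ γ) *
            ((Function.fixedPoints (φ γ)).ncard : ℂ) := by
  have := hΓ.countable
  obtain ⟨ϱ, hrank, hind, hspec, htrace⟩ := mainTheorem7_general Γ ρ n φ
  exact ⟨ϱ, by simp only [Module.finrank, hrank, map_mul, Cardinal.toNat_natCast], hind,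
    fun F D _ hF _ hD => hspec F D hF hD, htrace inferInstance⟩
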